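/- **Proposition 2.2.** Consider a market with $n$ divisible commodities, $N=\{1,\dots,n\}$. To each $s\in N$ there belong finite sets $I_s$ of traders and $J_s$ of buyers (a participant may be attributed to several commodities). Trader $i\in I_s$ chooses an offer $x_{is}$ with $\alpha'_{is}\le x_{is}\le\alpha''_{is}$, and buyer $j\in J_s$ chooses a bid $y_{js}$ with $\beta'_{js}\le y_{js}\le\beta''_{js}$, where $\alpha'_{is},\beta'_{js}\in\mathbb R$ and $\alpha''_{is},\beta''_{js}\in\mathbb R\cup\{+\infty\}$. Let $b_s\in\mathbb R$ be the external excess demand for commodity $s$, write $w=(x,y)$ with $x=(x_{is})_{s\in N,\,i\in I_s}$ and $y=(y_{js})_{s\in N,\,j\in J_s}$, and let $W$ be the set of all such $w$ that satisfy these bounds and $$\sum_{i\in I_s}x_{is}-\sum_{j\in J_s}y_{js}=b_s\qquad (s\in N).$$ The participants have real price functions $g_{is}(w)$ ($i\in I_s$) and $h_{js}(w)$ ($j\in J_s$), which may depend on the whole vector $w$. Suppose that $W$ is nonempty, that all $g_{is}$ and $h_{js}$ are continuous on $W$, and that the following condition holds. **(C)** There is a number $r>0$ such that for every $w=(x,y)\in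 W$, every $s\in N$ and every $l\in J_s$ with $\beta''_{ls}=+\infty$ and $y_{ls}>\max\{r,\beta'_{ls}\}$ there is $k\in I_s$ with $\alpha''_{ks}=+\infty$, $x_{ks}>\alpha'_{ks}$ and $g_{ks}(w)\ge h_{ls}(w)$. Then the variational inequality $$\sum_{s\in N}\Big[\sum_{i\in I_s}g_{is}(\bar w)(x_{is}-\bar x_{is})-\sum_{j\in J_s}h_{js}(\bar w)(y_{js}-\bar y_{js})\Big]\ge 0\qquad\text{for all } w=(x,y)\in W \tag{2.3}$$ has a solution $\bar w=(\bar x,\bar y)\in W$. If moreover $\alpha'_{is}<\alpha''_{is}$ and $\beta'_{js}<\beta''_{js}$ for all $s\in N$, $i\in I_s$, $j\in J_s$, then $\bar w$ is a market equilibrium point, that is, there is a price vector $\bar p\in\mathbb R^n$ such that for all $s\in N$: * for each $i\in I_s$: $g_{is}(\bar w)\ge\bar p_s$ if $\bar x_{is}=\alpha'_{is}$, $g_{is}(\bar w)=\bar p_s$ if $\alpha'_{is}<\bar x_{is}<\alpha''_{is}$, and $g_{is}(\bar w)\le\bar p_s$ if $\bar x_{is}=\alpha''_{is}$; * for each $j\in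 J_s$: $h_{js}(\bar w)\le\bar p_s$ if $\bar y_{js}=\beta'_{js}$, $h_{js}(\bar w)=\bar p_s$ if $\beta'_{js}<\bar y_{js}<\beta''_{js}$, and $h_{js}(\bar w)\ge\bar p_s$ if $\bar y_{js}=\beta''_{js}$. -/

import Mathlib

/-- Vectors `w = (x, y)` with `x = (x_{is})`, `i ∈ I_s`, and `y = (y_{js})`, `j ∈ J_s`, where `s`
runs over the `n` commodities. A participant may be attributed to several commodities. -/
abbrev MarketVector {n : ℕ} {I J : Type*} (traders : Fin n → Finset I)
    (buyers : Fin n → Finset J) : Type _ :=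
  ((s : Fin n) → traders s → ℝ) × ((s : Fin n) → buyers s → ℝ)

/-- The two-sided market model with `n` divisible commodities. The lower capacity bounds are real,
the upper ones may be `+∞`, and each price may depend on all offer and bid values. -/
structure Market (n : ℕ) (I J : Type*) where
  /-- The finite set `I_s` of traders attributed to commodity `s`. -/
  traders : Fin n → Finset I
  /-- The finite set `J_s` of buyers attributed to commodity `s`. -/
  buyers : Fin n → Finset J
  /-- `α'_{is}` -/
  offerLower : (s : Fin n) → traders s → ℝ
  /-- `α''_{is}` -/
  offerUpper : (s : Fin n) → traders s → WithTop ℝ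
  /-- `β'_{js}` -/
  bidLower : (s : Fin n) → buyers s → ℝ
  /-- `β''_{js}` -/
  bidUpper : (s : Fin n) → buyers s → WithTop ℝ
  /-- The external excess demand `b_s`. -/
  excessDemand : Fin n → ℝ
  /-- `g_{is}` -/
  offerPrice : (s : Fin n) → traders s → MarketVector traders buyers → ℝ
  /-- `h_{js}` -/
  bidPrice : (s : Fin n) → buyers s → MarketVector traders buyers → ℝ

namespace Market

variable {n : ℕ} {I J : Type*}

/-- The space of the vectors `w = (x, y)` of a market. -/
abbrev Vec (M : Market n I J) : Type _ := MarketVector M.traders M.buyers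

/-- The feasible set `W_s` of commodity `s`. -/
def feasibleFor (M : Market n I J) (s : Fin n) :
    Set ((M.traders s → ℝ) × (M.buyers s → ℝ)) :=
  {v | ∑ i, v.1 i - ∑ j, v.2 j = M.excessDemand s ∧
    (∀ i, M.offerLower s i ≤ v.1 i ∧ (v.1 i : WithTop ℝ) ≤ M.offerUpper s i) ∧
    (∀ j, M.bidLower s j ≤ v.2 j ∧ (v.2 j : WithTop ℝ) ≤ M.bidUpper s j)}

/-- The feasible set `W`, the product of the sets `W_s`. -/
def feasible (M : Market n I J) : Set M.Vec :=
  {w | ∀ s, (w.1 s, w.2 s) ∈ M.feasibleFor s}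

/-- `w` solves the variational inequality of the market. -/
def SolvesVI (M : Market n I J) (w : M.Vec) : Prop :=
  w ∈ M.feasible ∧ ∀ v ∈ M.feasible,
    0 ≤ ∑ s, (∑ i, M.offerPrice s i w * (v.1 s i - w.1 s i)
      - ∑ j, M.bidPrice s j w * (v.2 s j - w.2 s j))

/-- The equilibrium conditions on the traders, for the vector `w` and the price vector `p`. -/
def TraderConditions (M : Market n I J) (w : M.Vec) (p : Fin n → ℝ) : Prop :=
  ∀ (s : Fin n) (i : M.traders s),
    (w.1 s i = M.offerLower s i → p s ≤ M.offerPrice s i w) ∧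
    (M.offerLower s i < w.1 s i ∧ (w.1 s i : WithTop ℝ) < M.offerUpper s i →
      M.offerPrice s i w = p s) ∧
    ((w.1 s i : WithTop ℝ) = M.offerUpper s i → M.offerPrice s i w ≤ p s)

/-- The equilibrium conditions on the buyers, for the vector `w` and the price vector `p`. -/
def BuyerConditions (M : Market n I J) (w : M.Vec) (p : Fin n → ℝ) : Prop :=
  ∀ (s : Fin n) (j : M.buyers s),
    (w.2 s j = M.bidLower s j → M.bidPrice s j w ≤ p s) ∧
    (M.bidLower s j < w.2 s j ∧ (w.2 s j : WithTop ℝ) < M.bidUpper s j →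
      M.bidPrice s j w = p s) ∧
    ((w.2 s j : WithTop ℝ) = M.bidUpper s j → p s ≤ M.bidPrice s j w)

/-- `w` is a market equilibrium point. -/
def IsEquilibriumPoint (M : Market n I J) (w : M.Vec) : Prop :=
  w ∈ M.feasible ∧ ∃ p : Fin n → ℝ, M.TraderConditions w p ∧ M.BuyerConditions w p

/-- The coercivity condition (C). -/
def Coercive (M : Market n I J) : Prop :=
  ∃ r : ℝ, 0 < r ∧ ∀ w ∈ M.feasible, ∀ (s : Fin n) (l : M.buyers s), M.bidUpper s l = ⊤ →
    max r (M.bidLower s l) < w.2 s l →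
      ∃ k : M.traders s, M.offerUpper s k = ⊤ ∧ M.offerLower s k < w.1 s k ∧
        M.bidPrice s l w ≤ M.offerPrice s k w

/-- No capacity segment is reduced to a single point. -/
def Nondegenerate (M : Market n I J) : Prop :=
  (∀ (s : Fin n) (i : M.traders s), (M.offerLower s i : WithTop ℝ) < M.offerUpper s i) ∧
  (∀ (s : Fin n) (j : M.buyers s), (M.bidLower s j : WithTop ℝ) < M.bidUpper s j)

end Market

/-!
An equilibrium price vector is a Lagrange multiplier for the balance constraints in the variational
inequality. If `w` is a solution, then moving a small amount of commodity `s` from one participant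
to another does not lower the cost, so the prices of those who can give some up lie below the
prices of those who can take more, and any number `p_s` between the two groups serves. Conversely,
such multipliers imply the variational inequality.

If all bids are bounded, then `W` is compact and the variational inequality is solvable by the
Hartman–Stampacchia theorem. In general, impose a bound `R` on the unbounded bids. Prices for the
capped market fail to support `w` in the original one only if a bid stays at `R` although its price
exceeds `p_s`; condition (C) then provides a trader with a price at least as high who can reduce
the offer, so that this price is at most `p_s` after all.

Hartman–Stampacchia follows from Brouwer's theorem applied to `x ↦ P (x - F x)`, with `P` the
metric projection. Brouwer's theorem is proved as by Milnor and Rogers: let `r` be a smooth map of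
a bounded convex open set into its closure which fixes the boundary. Along the segment from the
identity to `r` the integral of the Jacobian determinant is a polynomial in the time `t`, and for
small `t`, where the map is a bijection, it equals the volume of the set. For a retraction onto a
sphere it would vanish at `t = 1`.
-/

open MeasureTheory Metric Set Polynomial
open scoped NNReal Topology

section Determinants

theorem exists_polynomial_eval_eq_det_add_smul {R V : Type*} [CommRing R] [Nontrivial R]
    [AddCommGroup V] [Module R V] [Module.Free R V] [Module.Finite R V] (A B : V →ₗ[R] V) :
    ∃ P : R[X], P.natDegree ≤ Module.finrank R V ∧ ∀ t, P.eval t = LinearMap.det (A + t • B) := by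
  let b := Module.finBasis R V
  let M := LinearMap.toMatrix b b
  refine ⟨((X : R[X]) • (M B).map C + (M A).map C).det, ?_, fun t => ?_⟩
  · simpa using natDegree_det_X_add_C_le (M B) (M A)
  · rw [← LinearMap.det_toMatrix b, ← coe_evalRingHom, RingHom.map_det, add_comm A]
    congr 1
    ext i j
    simp [M, mul_comm t]

theorem det_one_add_pos_of_norm_lt_one {E : Type*} [NormedAddCommGroup E] [NormedSpace ℝ E]
    [FiniteDimensional ℝ E] {A : E →L[ℝ] E} (hA : ‖A‖ < 1) : 0 < (1 + A).det := by
  have : CompleteSpace E := FiniteDimensional.complete ℝ E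
  have det_ne_zero : ∀ B ∈ ball (0 : E →L[ℝ] E) 1, (1 + B).det ≠ 0 := fun B hB => by
    have hB : IsUnit (1 - -B) := isUnit_one_sub_of_norm_lt_one (by simpa using hB)
    rw [sub_neg_eq_add] at hB
    exact ((hB.map ContinuousLinearMap.toLinearMapRingHom).map LinearMap.det).ne_zero
  have continuous_det : Continuous fun B : E →L[ℝ] E => (1 + B).det :=
    ContinuousLinearMap.continuous_det.comp (by fun_prop)
  by_contra! hdet
  obtain ⟨B, hB, hB0⟩ := (convex_ball (0 : E →L[ℝ] E) 1).isPreconnected.intermediate_value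
    (by simpa using hA : A ∈ ball 0 1) (mem_ball_self one_pos) continuous_det.continuousOn
    (⟨hdet, by simp [ContinuousLinearMap.det]⟩ : (0 : ℝ) ∈ Icc _ _)
  exact det_ne_zero B hB hB0

theorem integral_eval_eq_of_infinite {Ω : Type*} [MeasurableSpace Ω] {μ : Measure Ω}
    {P : Ω → ℝ[X]} {d : ℕ} (hdeg : ∀ ω, (P ω).natDegree ≤ d) {T : Set ℝ} (hT : T.Infinite)
    {V : ℝ} (hint : ∀ t ∈ T, Integrable (fun ω => (P ω).eval t) μ)
    (hV : ∀ t ∈ T, ∫ ω, (P ω).eval t ∂μ = V) (t : ℝ) : ∫ ω, (P ω).eval t ∂μ = V := by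
  obtain ⟨S, hST, hcard⟩ := hT.exists_subset_card_eq (d + 1)
  let c u := (Lagrange.basis S id u).eval t
  have hinj : InjOn id (S : Set ℝ) := injOn_id _
  have hne : S.Nonempty := Finset.card_pos.1 (by lia)
  have sum_c : ∑ u ∈ S, c u = 1 := by
    rw [← eval_finsetSum, Lagrange.sum_basis hinj hne, eval_one]
  have interpolation : ∀ ω, (P ω).eval t = ∑ u ∈ S, (P ω).eval u * c u := fun ω => by
    have hlt : (P ω).degree < S.card :=
      degree_le_natDegree.trans_lt (by exact_mod_cast (hdeg ω).trans_lt (by lia))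
    conv_lhs => rw [Lagrange.eq_interpolate hinj hlt, Lagrange.interpolate_apply]
    simp only [eval_finsetSum, eval_mul, eval_C, id, c]
  calc ∫ ω, (P ω).eval t ∂μ
      = ∑ u ∈ S, (∫ ω, (P ω).eval u ∂μ) * c u := by
        simp only [interpolation]
        rw [integral_finsetSum _ fun u hu => (hint u (hST hu)).mul_const _]
        simp only [integral_mul_const]
    _ = ∑ u ∈ S, V * c u := Finset.sum_congr rfl fun u hu => by rw [hV u (hST hu)]
    _ = V := by rw [← Finset.mul_sum, sum_c, mul_one]

end Determinants

section Brouwer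

variable {E : Type*} [NormedAddCommGroup E] [NormedSpace ℝ E] [FiniteDimensional ℝ E]
  {U : Set E} {r : E → E}

theorem injOn_and_image_eq_of_lipschitzOnWith_sub_id (hU : IsOpen U) (hUc : IsPreconnected U)
    (hUb : Bornology.IsBounded U) {c : ℝ≥0} (hc : c < 1)
    (hlip : LipschitzOnWith c (r - id) (closure U)) (hmaps : MapsTo r U U)
    (hid : EqOn r id (frontier U)) : InjOn r U ∧ r '' U = U := by
  have : CompleteSpace E := FiniteDimensional.complete ℝ E
  let e := ContinuousLinearEquiv.refl ℝ E
  have approx : ApproximatesLinearOn r (e : E →L[ℝ] E) (closure U) c :=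
    LipschitzOnWith.approximatesLinearOn hlip
  have hce : Subsingleton E ∨ c < ‖(e.symm : E →L[ℝ] E)‖₊⁻¹ := by
    rcases subsingleton_or_nontrivial E with hE | hE
    · exact .inl hE
    · exact .inr (by simpa [e] using hc)
  have injOn : InjOn r U := (approx.injOn hce).mono subset_closure
  refine ⟨injOn, hmaps.image_subset.antisymm ?_⟩
  have isOpen_image : IsOpen (r '' U) :=
    (approx.mono_set subset_closure).open_image e.toNonlinearRightInverse hU hce
  have closure_image : closure (r '' U) ⊆ r '' closure U :=
    closure_minimal (image_mono subset_closure)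
      (hUb.isCompact_closure.image_of_continuousOn approx.continuousOn).isClosed
  rcases U.eq_empty_or_nonempty with rfl | ⟨x₀, hx₀⟩
  · exact empty_subset _
  refine hUc.subset_of_closure_inter_subset isOpen_image
    ⟨r x₀, hmaps hx₀, mem_image_of_mem r hx₀⟩ ?_
  rintro y ⟨hy, hyU⟩
  obtain ⟨x, hx, rfl⟩ := closure_image hy
  by_contra hxU
  have hxf : x ∈ frontier U := ⟨hx, fun hxi => hxU (mem_image_of_mem r (interior_subset hxi))⟩
  rw [show r x = x from hid hxf] at hyU
  exact hxf.2 (hU.interior_eq.symm ▸ hyU)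

theorem setIntegral_det_fderiv_eq_of_lipschitzOnWith_sub_id [MeasurableSpace E] [BorelSpace E]
    (μ : Measure E) [μ.IsAddHaarMeasure] (hU : IsOpen U) (hUc : IsPreconnected U)
    (hUb : Bornology.IsBounded U) {c : ℝ≥0} (hc : c < 1)
    (hlip : LipschitzOnWith c (r - id) (closure U)) (hr : DifferentiableOn ℝ r U)
    (hmaps : MapsTo r U U) (hid : EqOn r id (frontier U)) :
    ∫ x in U, (fderiv ℝ r x).det ∂μ = μ.real U := by
  obtain ⟨injOn, image_eq⟩ :=
    injOn_and_image_eq_of_lipschitzOnWith_sub_id hU hUc hUb hc hlip hmaps hid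
  have det_pos : ∀ x ∈ U, 0 < (fderiv ℝ r x).det := fun x hx => by
    have norm_lt : ‖fderiv ℝ (r - id) x‖ < 1 :=
      (norm_fderiv_le_of_lipschitzOn ℝ (hU.mem_nhds hx) (hlip.mono subset_closure)).trans_lt hc
    rw [fderiv_sub (hr.differentiableAt (hU.mem_nhds hx)) differentiableAt_id, fderiv_id]
      at norm_lt
    simpa [ContinuousLinearMap.one_def] using det_one_add_pos_of_norm_lt_one norm_lt
  calc ∫ x in U, (fderiv ℝ r x).det ∂μ
      = ∫ x in U, |(fderiv ℝ r x).det| • (1 : ℝ) ∂μ :=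
        setIntegral_congr_fun hU.measurableSet fun x hx => by simp [abs_of_pos (det_pos x hx)]
    _ = ∫ _ in r '' U, (1 : ℝ) ∂μ :=
        (integral_image_eq_integral_abs_det_fderiv_smul μ hU.measurableSet
          (fun x hx => (hr.differentiableAt (hU.mem_nhds hx)).hasFDerivAt.hasFDerivWithinAt)
          injOn fun _ => 1).symm
    _ = μ.real U := by simp [image_eq]

theorem setIntegral_det_fderiv_path_eq [MeasurableSpace E] [BorelSpace E] (μ : Measure E)
    [μ.IsAddHaarMeasure] (hU : IsOpen U) (hUc : Convex ℝ U) (hUb : Bornology.IsBounded U)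
    {K : ℝ≥0} (hlip : LipschitzOnWith K (r - id) (closure U)) (hr : DifferentiableOn ℝ r U)
    (hmaps : MapsTo r U (closure U)) (hid : EqOn r id (frontier U)) {t : ℝ} (ht0 : 0 ≤ t)
    (ht1 : t < 1) (htK : t * K < 1) :
    ∫ x in U, (fderiv ℝ (id + t • (r - id)) x).det ∂μ = μ.real U := by
  refine setIntegral_det_fderiv_eq_of_lipschitzOnWith_sub_id μ hU hUc.isPreconnected hUb
    (c := ‖t‖₊ * K) ?_ ?_ (differentiableOn_id.add ((hr.sub differentiableOn_id).const_smul t))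
    (fun x hx => ?_) fun x hx => by simp [hid hx]
  · rw [← NNReal.coe_lt_coe]
    simpa [abs_of_nonneg ht0] using htK
  · rw [add_sub_cancel_left]
    exact (lipschitzWith_smul t).comp_lipschitzOnWith hlip
  · have combo_mem : (1 - t) • x + t • r x ∈ interior U :=
      hUc.combo_interior_closure_mem_interior (hU.interior_eq.symm ▸ hx) (hmaps hx)
        (sub_pos.2 ht1) ht0 (sub_add_cancel 1 t)
    convert interior_subset combo_mem using 1
    simp only [Pi.add_apply, Pi.smul_apply, Pi.sub_apply, id]
    module

theorem setIntegral_det_fderiv_eq [MeasurableSpace E] [BorelSpace E] (μ : Measure E)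
    [μ.IsAddHaarMeasure] (hU : IsOpen U) (hUc : Convex ℝ U) (hUb : Bornology.IsBounded U)
    (hr : ContDiff ℝ 1 r) (hmaps : MapsTo r U (closure U)) (hid : EqOn r id (frontier U)) :
    ∫ x in U, (fderiv ℝ r x).det ∂μ = μ.real U := by
  let g := r - id
  have hg : ContDiff ℝ 1 g := hr.sub contDiff_id
  have hgd : Differentiable ℝ g := hg.differentiable one_ne_zero
  obtain ⟨K, hK⟩ := hg.contDiffOn.exists_lipschitzOnWith one_ne_zero hUc.closure
    hUb.isCompact_closure
  choose P hdeg hP using fun x =>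
    exists_polynomial_eval_eq_det_add_smul 1 (fderiv ℝ g x : E →ₗ[ℝ] E)
  have fderiv_path : ∀ (t : ℝ) x, (fderiv ℝ (id + t • g) x).det = (P x).eval t := fun t x => by
    rw [fderiv_add differentiableAt_id ((hgd x).const_smul t), fderiv_const_smul (hgd x),
      fderiv_id, hP]
    rfl
  have eval_eq : ∀ t ∈ Ico (0 : ℝ) (1 / (K + 1)), ∫ x in U, (P x).eval t ∂μ = μ.real U := by
    rintro t ⟨ht0, htK⟩
    rw [lt_div_iff₀ (by positivity)] at htK
    have htK0 := mul_nonneg ht0 K.coe_nonneg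
    simp only [← fderiv_path]
    exact setIntegral_det_fderiv_path_eq μ hU hUc hUb hK
      (hr.differentiable one_ne_zero).differentiableOn hmaps hid ht0 (by linarith) (by linarith)
  have integrable : ∀ t : ℝ, IntegrableOn (fun x => (P x).eval t) U μ := fun t => by
    simp only [hP]
    have : Continuous fun x => (1 + t • fderiv ℝ g x).det :=
      ContinuousLinearMap.continuous_det.comp
        (continuous_const.add ((hg.continuous_fderiv one_ne_zero).const_smul t))
    exact (this.continuousOn.integrableOn_compact hUb.isCompact_closure).mono_set subset_closure
  have eval_one_eq := integral_eval_eq_of_infinite hdeg (Ico_infinite (by positivity))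
    (fun t _ => integrable t) eval_eq 1
  simpa only [← fderiv_path, one_smul, g, add_sub_cancel] using eval_one_eq

end Brouwer

section BrouwerInner

variable {E : Type*} [NormedAddCommGroup E] [InnerProductSpace ℝ E]

theorem det_fderiv_eq_zero_of_norm_eventuallyEq [FiniteDimensional ℝ E] {r : E → E} {x : E}
    {ρ : ℝ} (hρ : ρ ≠ 0) (hr : DifferentiableAt ℝ r x) (hnorm : ∀ᶠ y in 𝓝 x, ‖r y‖ = ρ) :
    (fderiv ℝ r x).det = 0 := by
  by_contra hdet
  obtain ⟨v, hv⟩ := ((fderiv ℝ r x).toContinuousLinearEquivOfDetNeZero hdet).surjective (r x)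
  have inner_fderiv : HasFDerivAt (fun y => ‖r y‖ ^ 2)
      (2 • (innerSL ℝ (r x)).comp (fderiv ℝ r x)) x :=
    hr.hasFDerivAt.norm_sq
  have hasFDerivAt_zero : HasFDerivAt (fun y => ‖r y‖ ^ 2) (0 : E →L[ℝ] ℝ) x :=
    (hasFDerivAt_const (ρ ^ 2) x).congr_of_eventuallyEq (hnorm.mono fun y hy => by simp [hy])
  have radial := DFunLike.congr_fun (inner_fderiv.unique hasFDerivAt_zero) v
  rw [ContinuousLinearMap.toContinuousLinearEquivOfDetNeZero_apply] at hv
  simp [hv, hnorm.self_of_nhds, hρ] at radial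

theorem not_exists_contDiff_retraction_sphere [FiniteDimensional ℝ E] {ρ : ℝ} (hρ : 0 < ρ) :
    ¬∃ r : E → E, ContDiff ℝ 1 r ∧ (∀ x, ‖r x‖ = ρ) ∧ ∀ x, ‖x‖ = ρ → r x = x := by
  rintro ⟨r, hr, hnorm, hid⟩
  borelize E
  have integral_eq := setIntegral_det_fderiv_eq (volume : Measure E) isOpen_ball
    (convex_ball 0 ρ) isBounded_ball hr
    (fun x _ => by simp [closure_ball (0 : E) hρ.ne', hnorm])
    (fun x hx => hid x (by simpa using frontier_ball_subset_sphere hx))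
  have det_eq_zero : ∀ x, (fderiv ℝ r x).det = 0 := fun x =>
    det_fderiv_eq_zero_of_norm_eventuallyEq hρ.ne' (hr.differentiable one_ne_zero x)
      (.of_forall hnorm)
  simp only [det_eq_zero, integral_zero] at integral_eq
  exact (ENNReal.toReal_pos (measure_ball_pos volume (0 : E) hρ).ne' measure_ball_lt_top.ne).ne
    integral_eq

theorem exists_fixedPoint_of_contDiff_of_norm_le [FiniteDimensional ℝ E] {f : E → E}
    (hf : ContDiff ℝ 1 f) {S : ℝ} (hS : ∀ x, ‖f x‖ ≤ S) : ∃ x, f x = x := by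
  by_contra! hne
  have hS0 : 0 ≤ S := (norm_nonneg _).trans (hS 0)
  let χ : ContDiffBump (0 : E) := ⟨S + 1, S + 2, by positivity, by linarith⟩
  let φ x := x - χ x • f x
  have φ_ne_zero : ∀ x, φ x ≠ 0 := fun x h => by
    have hx : x = χ x • f x := sub_eq_zero.1 h
    have norm_le : ‖x‖ ≤ S := by
      rw [hx, norm_smul, Real.norm_of_nonneg χ.nonneg]
      exact (mul_le_of_le_one_left (norm_nonneg _) χ.le_one).trans (hS x)
    have hχ : χ x = 1 := χ.one_of_mem_closedBall (by
      rw [mem_closedBall_zero_iff]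
      exact norm_le.trans (le_add_of_nonneg_right zero_le_one))
    rw [hχ, one_smul] at hx
    exact hne x hx.symm
  have hφ : ContDiff ℝ 1 φ := contDiff_id.sub (χ.contDiff.smul hf)
  refine not_exists_contDiff_retraction_sphere (E := E) (by positivity : 0 < S + 2)
    ⟨fun x => ((S + 2) * ‖φ x‖⁻¹) • φ x, ?_, fun x => ?_, fun x hx => ?_⟩
  · exact (contDiff_const.mul
      ((hφ.norm ℝ φ_ne_zero).inv fun x => norm_ne_zero_iff.2 (φ_ne_zero x))).smul hφ
  · have := norm_pos_iff.2 (φ_ne_zero x)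
    rw [norm_smul, Real.norm_of_nonneg (by positivity)]
    field_simp
  · have hφx : φ x = x := by
      simp [φ, χ.zero_of_le_dist (x := x) (by rw [dist_zero_right, hx])]
    simp only [hφx, hx, mul_inv_cancel₀ (by positivity : S + 2 ≠ 0), one_smul]

theorem exists_fixedPoint_of_continuous_of_norm_le [FiniteDimensional ℝ E] {f : E → E}
    (hf : Continuous f) {S : ℝ} (hS : ∀ x, ‖f x‖ ≤ S) : ∃ x, f x = x := by
  have approx_fixed : ∀ ε ∈ Ioc (0 : ℝ) 1, ∃ x ∈ closedBall (0 : E) (S + 1), ‖x - f x‖ < ε := by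
    rintro ε ⟨hε, hε1⟩
    obtain ⟨F, hF, hFf, -⟩ := hf.exists_contDiff_approx 1 (ε := fun _ => ε) continuous_const
      fun _ => hε
    have hFS : ∀ x, ‖F x‖ ≤ S + 1 := fun x => by
      have := norm_le_norm_add_norm_sub' (F x) (f x)
      linarith [hS x, dist_eq_norm (F x) (f x) ▸ hFf x]
    obtain ⟨x, hx⟩ := exists_fixedPoint_of_contDiff_of_norm_le hF hFS
    refine ⟨x, by simpa [hx] using hFS x, ?_⟩
    simpa [hx, dist_eq_norm] using hFf x
  obtain ⟨x₁, hx₁, -⟩ := approx_fixed 1 (by simp)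
  obtain ⟨x₀, -, hmin⟩ := (isCompact_closedBall (0 : E) (S + 1)).exists_isMinOn ⟨x₁, hx₁⟩
    (f := fun x => ‖x - f x‖) (by fun_prop)
  by_contra! hne
  have hpos : 0 < ‖x₀ - f x₀‖ := norm_pos_iff.2 (sub_ne_zero.2 (hne x₀).symm)
  obtain ⟨x, hx, hlt⟩ := approx_fixed (min ‖x₀ - f x₀‖ 1) ⟨lt_min hpos one_pos, min_le_right _ _⟩
  exact (hmin hx).not_gt (hlt.trans_le (min_le_left _ _))

end BrouwerInner

section VariationalInequality

theorem exists_continuous_projection {E : Type*} [NormedAddCommGroup E] [InnerProductSpace ℝ E]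
    {K : Set E} (hne : K.Nonempty) (hK : IsComplete K) (hconv : Convex ℝ K) :
    ∃ P : E → E, Continuous P ∧ (∀ x, P x ∈ K) ∧
      ∀ x, ∀ v ∈ K, inner ℝ (x - P x) (v - P x) ≤ 0 := by
  choose P hPK hP using fun x => exists_norm_eq_iInf_of_complete_convex hne hK hconv x
  have obtuse : ∀ x, ∀ v ∈ K, inner ℝ (x - P x) (v - P x) ≤ 0 := fun x =>
    (norm_eq_iInf_iff_real_inner_le_zero hconv (hPK x)).1 (hP x)
  refine ⟨P, (LipschitzWith.of_dist_le_mul (K := 1) fun x y => ?_).continuous, hPK, obtuse⟩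
  rw [dist_eq_norm, dist_eq_norm, NNReal.coe_one, one_mul]
  have firmly_nonexpansive : ‖P x - P y‖ ^ 2 ≤ inner ℝ (x - y) (P x - P y) := by
    have hx := obtuse x (P y) (hPK y)
    have hy := obtuse y (P x) (hPK x)
    rw [← real_inner_self_eq_norm_sq]
    simp only [inner_sub_left, inner_sub_right] at hx hy ⊢
    linarith
  have cauchy_schwarz := real_inner_le_norm (x - y) (P x - P y)
  by_contra! hlt
  nlinarith [norm_nonneg (x - y)]

theorem exists_fixedPoint_of_isCompact_of_convex {E : Type*} [NormedAddCommGroup E]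
    [InnerProductSpace ℝ E] [FiniteDimensional ℝ E] {K : Set E} (hne : K.Nonempty)
    (hK : IsCompact K) (hconv : Convex ℝ K) {f : E → E} (hf : ContinuousOn f K)
    (hmaps : MapsTo f K K) : ∃ x ∈ K, f x = x := by
  obtain ⟨P, hPc, hPK, obtuse⟩ := exists_continuous_projection hne hK.isComplete hconv
  have hPid : ∀ x ∈ K, P x = x := fun x hx => by
    have := obtuse x x hx
    rw [real_inner_self_nonpos, sub_eq_zero] at this
    exact this.symm
  obtain ⟨S, hS⟩ := hK.isBounded.exists_norm_le
  obtain ⟨x, hx⟩ := exists_fixedPoint_of_continuous_of_norm_le (hf.comp_continuous hPc hPK)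
    fun x => hS _ (hmaps (hPK x))
  have hxK : x ∈ K := hx ▸ hmaps (hPK x)
  exact ⟨x, hxK, by simpa only [Function.comp_apply, hPid x hxK] using hx⟩

theorem exists_inner_variational_inequality {E : Type*} [NormedAddCommGroup E]
    [InnerProductSpace ℝ E] [FiniteDimensional ℝ E] {K : Set E} (hne : K.Nonempty)
    (hK : IsCompact K) (hconv : Convex ℝ K) {F : E → E} (hF : ContinuousOn F K) :
    ∃ x ∈ K, ∀ v ∈ K, 0 ≤ inner ℝ (F x) (v - x) := by
  obtain ⟨P, hPc, hPK, obtuse⟩ := exists_continuous_projection hne hK.isComplete hconv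
  obtain ⟨x, hxK, hx⟩ := exists_fixedPoint_of_isCompact_of_convex hne hK hconv
    (hPc.comp_continuousOn (continuousOn_id.sub hF)) fun x _ => hPK (x - F x)
  refine ⟨x, hxK, fun v hv => ?_⟩
  have hvi := obtuse (x - F x) v hv
  rw [show P (x - F x) = x from hx, sub_sub_cancel_left, inner_neg_left] at hvi
  exact neg_nonpos.1 hvi

theorem exists_variational_inequality {E : Type*} [NormedAddCommGroup E] [NormedSpace ℝ E]
    [FiniteDimensional ℝ E] {K : Set E} (hne : K.Nonempty) (hK : IsCompact K)
    (hconv : Convex ℝ K) {F : E → E →L[ℝ] ℝ} (hF : ContinuousOn F K) :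
    ∃ x ∈ K, ∀ v ∈ K, 0 ≤ F x (v - x) := by
  let e := (toEuclidean : E ≃L[ℝ] EuclideanSpace ℝ (Fin (Module.finrank ℝ E)))
  obtain ⟨x, hx, h⟩ := exists_inner_variational_inequality (K := e.symm ⁻¹' K)
    (F := fun x => (InnerProductSpace.toDual ℝ _).symm ((F (e.symm x)).comp (e.symm : _ →L[ℝ] E)))
    (hne.preimage e.symm.surjective) (e.symm.toHomeomorph.isCompact_preimage.2 hK)
    (hconv.linear_preimage e.symm.toLinearMap) (by
      refine (LinearIsometryEquiv.continuous _).comp_continuousOn ?_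
      exact ContinuousOn.clm_comp (hF.comp e.symm.continuous.continuousOn fun _ hx => hx)
        continuousOn_const)
  refine ⟨e.symm x, hx, fun v hv => ?_⟩
  have := h (e v) (by simpa using hv)
  simpa [InnerProductSpace.toDual_symm_apply] using this

end VariationalInequality

section Allocations

variable {κ : Type*} [Fintype κ]

/-- The ways of dividing the amount `b` of a single commodity among the participants `κ`, where
participant `k` may receive the amounts in `A k`. -/
def allocations (A : κ → Set ℝ) (b : ℝ) : Set (κ → ℝ) :=
  {z | (∀ k, z k ∈ A k) ∧ ∑ k, z k = b}

variable {A : κ → Set ℝ} {b : ℝ} {z G : κ → ℝ}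

theorem le_of_exchange (hA : ∀ k, (A k).OrdConnected) (hz : z ∈ allocations A b)
    (hvi : ∀ v ∈ allocations A b, 0 ≤ G ⬝ᵥ (v - z)) {k l : κ} {t u : ℝ} (ht : t ∈ A k)
    (hzt : z k < t) (hu : u ∈ A l) (huz : u < z l) : G l ≤ G k := by
  classical
  rcases eq_or_ne k l with rfl | hkl
  · rfl
  let δ := min (t - z k) (z l - u)
  have hδ : 0 < δ := lt_min (sub_pos.2 hzt) (sub_pos.2 huz)
  have hδt : δ ≤ t - z k := min_le_left _ _
  have hδu : δ ≤ z l - u := min_le_right _ _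
  let v := z + (Pi.single k δ - Pi.single l δ)
  have hv : v ∈ allocations A b := by
    refine ⟨fun m => ?_, by simp [v, Finset.sum_add_distrib, hz.2]⟩
    rcases eq_or_ne m k with rfl | hmk
    · have hvm : v m = z m + δ := by simp [v, hkl]
      exact (hA m).out (hz.1 m) ht ⟨by linarith, by linarith⟩
    rcases eq_or_ne m l with rfl | hml
    · have hvm : v m = z m - δ := by simp [v, hmk, sub_eq_add_neg]
      exact (hA m).out hu (hz.1 m) ⟨by linarith, by linarith⟩
    · simpa [v, hmk, hml] using hz.1 m
  have gain : 0 ≤ (G k - G l) * δ := by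
    simpa [v, dotProduct_sub, sub_mul] using hvi v hv
  exact sub_nonneg.1 (nonneg_of_mul_nonneg_left gain hδ)

theorem exists_between_of_finite {α : Type*} [LinearOrder α] [Nonempty α] {L U : Set α}
    (hL : L.Finite) (hU : U.Finite) (h : ∀ x ∈ L, ∀ y ∈ U, x ≤ y) :
    ∃ c, (∀ x ∈ L, x ≤ c) ∧ ∀ y ∈ U, c ≤ y := by
  rcases L.eq_empty_or_nonempty with rfl | hne
  · obtain ⟨c, hc⟩ := hU.bddBelow
    exact ⟨c, by simp, fun y hy => hc hy⟩
  · obtain ⟨c, hcL, hc⟩ := L.exists_max_image id hL hne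
    exact ⟨c, hc, h c hcL⟩

theorem exists_price_of_variational_inequality (hA : ∀ k, (A k).OrdConnected)
    (hz : z ∈ allocations A b) (hvi : ∀ v ∈ allocations A b, 0 ≤ G ⬝ᵥ (v - z)) :
    ∃ c, ∀ k, ∀ t ∈ A k, 0 ≤ (G k - c) * (t - z k) := by
  obtain ⟨c, hdec, hinc⟩ := exists_between_of_finite
    (L := G '' {l | ∃ u ∈ A l, u < z l}) (U := G '' {k | ∃ t ∈ A k, z k < t})
    ((toFinite _).image G) ((toFinite _).image G) (by
      rintro _ ⟨l, ⟨u, hu, huz⟩, rfl⟩ _ ⟨k, ⟨t, ht, hzt⟩, rfl⟩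
      exact le_of_exchange hA hz hvi ht hzt hu huz)
  refine ⟨c, fun k t ht => ?_⟩
  rcases lt_trichotomy (z k) t with hlt | heq | hlt
  · exact mul_nonneg (sub_nonneg.2 (hinc _ ⟨k, ⟨t, ht, hlt⟩, rfl⟩)) (sub_nonneg.2 hlt.le)
  · simp [heq]
  · exact mul_nonneg_of_nonpos_of_nonpos (sub_nonpos.2 (hdec _ ⟨k, ⟨t, ht, hlt⟩, rfl⟩))
      (sub_nonpos.2 hlt.le)

theorem exists_price_of_two_sided_variational_inequality {ι κ : Type*} [Fintype ι] [Fintype κ]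
    {A : ι → Set ℝ} {B : κ → Set ℝ} (hA : ∀ i, (A i).OrdConnected)
    (hB : ∀ j, (B j).OrdConnected) {x g : ι → ℝ} {y h : κ → ℝ} (hx : ∀ i, x i ∈ A i)
    (hy : ∀ j, y j ∈ B j)
    (hvi : ∀ x' y', (∀ i, x' i ∈ A i) → (∀ j, y' j ∈ B j) →
      ∑ i, x' i - ∑ j, y' j = ∑ i, x i - ∑ j, y j → 0 ≤ g ⬝ᵥ (x' - x) - h ⬝ᵥ (y' - y)) :
    ∃ c, (∀ i, ∀ t ∈ A i, 0 ≤ (g i - c) * (t - x i)) ∧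
      ∀ j, ∀ t ∈ B j, 0 ≤ (c - h j) * (t - y j) := by
  -- A bid counts as a negative amount, so that all participants are treated alike.
  let C : ι ⊕ κ → Set ℝ := Sum.elim A fun j => Neg.neg ⁻¹' B j
  have ordConnected : ∀ k, (C k).OrdConnected := by
    rintro (i | j)
    · exact hA i
    · exact (hB j).preimage_anti fun _ _ => neg_le_neg
  have hz : Sum.elim x (-y) ∈ allocations C (∑ i, x i - ∑ j, y j) := by
    refine ⟨?_, by simp [sub_eq_add_neg]⟩
    rintro (i | j)
    · exact hx i
    · simpa [C] using hy j
  obtain ⟨c, hc⟩ := exists_price_of_variational_inequality (G := Sum.elim g h) ordConnected hz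
    fun v hv => by
      have hv' := hvi (v ∘ Sum.inl) (-v ∘ Sum.inr) (fun i => hv.1 (.inl i))
        (fun j => hv.1 (.inr j)) (by simpa using hv.2)
      convert hv' using 1
      simp only [dotProduct, Fintype.sum_sum_type, sub_eq_add_neg, ← Finset.sum_neg_distrib]
      simp [mul_add, add_comm]
  refine ⟨c, fun i t ht => hc (.inl i) t ht, fun j t ht => ?_⟩
  have := hc (.inr j) (-t) (by simpa [C] using ht)
  simp only [Sum.elim_inr, Pi.neg_apply] at this
  linarith

end Allocations

section CapacitySegments

/-- The volumes between the capacity bounds `a` and `u`; an upper bound `⊤` is no restriction. -/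
def capacitySegment (a : ℝ) (u : WithTop ℝ) : Set ℝ :=
  {t | a ≤ t ∧ (t : WithTop ℝ) ≤ u}

variable {a x c : ℝ} {u : WithTop ℝ}

theorem isClosed_capacitySegment (a : ℝ) (u : WithTop ℝ) : IsClosed (capacitySegment a u) := by
  cases u with
  | top =>
    rw [show capacitySegment a ⊤ = Ici a by ext; simp [capacitySegment]]
    exact isClosed_Ici
  | coe d =>
    rw [show capacitySegment a d = Icc a d by ext; simp [capacitySegment]]
    exact isClosed_Icc

theorem ordConnected_capacitySegment (a : ℝ) (u : WithTop ℝ) :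
    (capacitySegment a u).OrdConnected :=
  ⟨fun _ hx _ hy _ ht => ⟨hx.1.trans ht.1, (WithTop.coe_le_coe.2 ht.2).trans hy.2⟩⟩

theorem nonpos_of_lower_lt (hx : x ∈ capacitySegment a u)
    (hc : ∀ t ∈ capacitySegment a u, 0 ≤ c * (t - x)) (hax : a < x) : c ≤ 0 :=
  nonpos_of_mul_nonneg_left (hc a ⟨le_rfl, (WithTop.coe_le_coe.2 hx.1).trans hx.2⟩)
    (sub_neg.2 hax)

theorem nonneg_of_lt_upper (hx : x ∈ capacitySegment a u)
    (hc : ∀ t ∈ capacitySegment a u, 0 ≤ c * (t - x)) (hxu : (x : WithTop ℝ) < u) : 0 ≤ c := by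
  obtain ⟨t, hxt, htu⟩ : ∃ t : ℝ, x < t ∧ (t : WithTop ℝ) ≤ u := by
    cases u with
    | top => exact ⟨x + 1, lt_add_one x, le_top⟩
    | coe d => exact ⟨d, WithTop.coe_lt_coe.1 hxu, le_rfl⟩
  exact nonneg_of_mul_nonneg_left (hc t ⟨hx.1.trans hxt.le, htu⟩) (sub_pos.2 hxt)

theorem complementarity_of_lower_lt_upper (hau : (a : WithTop ℝ) < u)
    (hx : x ∈ capacitySegment a u) (hc : ∀ t ∈ capacitySegment a u, 0 ≤ c * (t - x)) :
    (x = a → 0 ≤ c) ∧ (a < x ∧ (x : WithTop ℝ) < u → c = 0) ∧ ((x : WithTop ℝ) = u → c ≤ 0) :=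
  ⟨fun h => nonneg_of_lt_upper hx hc (h ▸ hau),
    fun h => (nonpos_of_lower_lt hx hc h.1).antisymm (nonneg_of_lt_upper hx hc h.2),
    fun h => nonpos_of_lower_lt hx hc (WithTop.coe_lt_coe.1 (h ▸ hau))⟩

end CapacitySegments

namespace Market

variable {n : ℕ} {I J : Type*} {M : Market n I J} {w : M.Vec} {p : Fin n → ℝ} {R : ℝ}

section SupportingPrice

/-- At the prices `p`, and with their own price functions frozen at `w`, no participant profits
from moving to another volume between the capacity bounds: the price vector `p` is a Lagrange
multiplier for the balance constraints in the variational inequality of the market. -/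
def IsSupportingPrice (M : Market n I J) (w : M.Vec) (p : Fin n → ℝ) : Prop :=
  ∀ s,
    (∀ i, ∀ t ∈ capacitySegment (M.offerLower s i) (M.offerUpper s i),
      0 ≤ (M.offerPrice s i w - p s) * (t - w.1 s i)) ∧
    (∀ j, ∀ t ∈ capacitySegment (M.bidLower s j) (M.bidUpper s j),
      0 ≤ (p s - M.bidPrice s j w) * (t - w.2 s j))

theorem update_mem_feasible (hw : w ∈ M.feasible) {s : Fin n}
    {v : (M.traders s → ℝ) × (M.buyers s → ℝ)} (hv : v ∈ M.feasibleFor s) :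
    (Function.update w.1 s v.1, Function.update w.2 s v.2) ∈ M.feasible := by
  intro s'
  rcases eq_or_ne s' s with rfl | hs
  · simpa using hv
  · simpa [hs] using hw s'

theorem SolvesVI.commodity_nonneg (h : M.SolvesVI w) {s : Fin n}
    {v : (M.traders s → ℝ) × (M.buyers s → ℝ)} (hv : v ∈ M.feasibleFor s) :
    0 ≤ ∑ i, M.offerPrice s i w * (v.1 i - w.1 s i)
      - ∑ j, M.bidPrice s j w * (v.2 j - w.2 s j) := by
  have hvi := h.2 _ (update_mem_feasible h.1 hv)
  rw [Fintype.sum_eq_single s fun s' hs => by simp [hs]] at hvi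
  simpa only [Function.update_self] using hvi

theorem SolvesVI.exists_isSupportingPrice (h : M.SolvesVI w) :
    ∃ p, M.IsSupportingPrice w p := by
  suffices ∀ s, ∃ c,
      (∀ i, ∀ t ∈ capacitySegment (M.offerLower s i) (M.offerUpper s i),
        0 ≤ (M.offerPrice s i w - c) * (t - w.1 s i)) ∧
      (∀ j, ∀ t ∈ capacitySegment (M.bidLower s j) (M.bidUpper s j),
        0 ≤ (c - M.bidPrice s j w) * (t - w.2 s j)) by
    choose p hp using this
    exact ⟨p, hp⟩
  intro s
  exact exists_price_of_two_sided_variational_inequality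
    (fun i => ordConnected_capacitySegment _ _) (fun j => ordConnected_capacitySegment _ _)
    (h.1 s).2.1 (h.1 s).2.2
    fun x y hx hy hxy => h.commodity_nonneg (v := (x, y)) ⟨hxy.trans (h.1 s).1, hx, hy⟩

theorem IsSupportingPrice.solvesVI (hp : M.IsSupportingPrice w p) (hw : w ∈ M.feasible) :
    M.SolvesVI w := by
  refine ⟨hw, fun v hv => Finset.sum_nonneg fun s _ => ?_⟩
  calc 0
      ≤ ∑ i, (M.offerPrice s i w - p s) * (v.1 s i - w.1 s i)
          + ∑ j, (p s - M.bidPrice s j w) * (v.2 s j - w.2 s j) :=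
        add_nonneg (Finset.sum_nonneg fun i _ => (hp s).1 i _ ((hv s).2.1 i))
          (Finset.sum_nonneg fun j _ => (hp s).2 j _ ((hv s).2.2 j))
    _ = ∑ i, M.offerPrice s i w * (v.1 s i - w.1 s i)
          - ∑ j, M.bidPrice s j w * (v.2 s j - w.2 s j)
          - p s * ((∑ i, v.1 s i - ∑ j, v.2 s j) - (∑ i, w.1 s i - ∑ j, w.2 s j)) := by
        simp only [sub_mul, Finset.sum_sub_distrib, ← Finset.mul_sum]
        ring
    _ = ∑ i, M.offerPrice s i w * (v.1 s i - w.1 s i)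
          - ∑ j, M.bidPrice s j w * (v.2 s j - w.2 s j) := by
        rw [(hv s).1, (hw s).1, sub_self, mul_zero, sub_zero]

theorem IsSupportingPrice.traderConditions (hp : M.IsSupportingPrice w p) (hw : w ∈ M.feasible)
    (hM : M.Nondegenerate) : M.TraderConditions w p := fun s i => by
  simpa only [sub_nonneg, sub_nonpos, sub_eq_zero] using
    complementarity_of_lower_lt_upper (hM.1 s i) ((hw s).2.1 i) ((hp s).1 i)

theorem IsSupportingPrice.buyerConditions (hp : M.IsSupportingPrice w p) (hw : w ∈ M.feasible)
    (hM : M.Nondegenerate) : M.BuyerConditions w p := fun s j => by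
  simpa only [sub_nonneg, sub_nonpos, sub_eq_zero, eq_comm (a := p s)] using
    complementarity_of_lower_lt_upper (hM.2 s j) ((hw s).2.2 j) ((hp s).2 j)

theorem SolvesVI.isEquilibriumPoint (h : M.SolvesVI w) (hM : M.Nondegenerate) :
    M.IsEquilibriumPoint w :=
  let ⟨p, hp⟩ := h.exists_isSupportingPrice
  ⟨h.1, p, hp.traderConditions h.1 hM, hp.buyerConditions h.1 hM⟩

end SupportingPrice

section BoundedBids

theorem convex_feasible (M : Market n I J) : Convex ℝ M.feasible := by
  intro v hv w hw a b ha hb hab s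
  refine ⟨?_, fun i => (ordConnected_capacitySegment _ _).convex ((hv s).2.1 i) ((hw s).2.1 i)
    ha hb hab, fun j => (ordConnected_capacitySegment _ _).convex ((hv s).2.2 j) ((hw s).2.2 j)
    ha hb hab⟩
  calc ∑ i, (a * v.1 s i + b * w.1 s i) - ∑ j, (a * v.2 s j + b * w.2 s j)
      = a * (∑ i, v.1 s i - ∑ j, v.2 s j) + b * (∑ i, w.1 s i - ∑ j, w.2 s j) := by
        simp only [Finset.sum_add_distrib, ← Finset.mul_sum]
        ring
    _ = M.excessDemand s := by rw [(hv s).1, (hw s).1, ← add_mul, hab, one_mul]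

theorem isClosed_feasible (M : Market n I J) : IsClosed M.feasible := by
  have isClosed_balanced (s) :
      IsClosed {w : M.Vec | ∑ i, w.1 s i - ∑ j, w.2 s j = M.excessDemand s} :=
    isClosed_eq (by fun_prop) continuous_const
  have isClosed_offers (s i) : IsClosed
      {w : M.Vec | w.1 s i ∈ capacitySegment (M.offerLower s i) (M.offerUpper s i)} :=
    (isClosed_capacitySegment _ _).preimage (by fun_prop)
  have isClosed_bids (s j) : IsClosed
      {w : M.Vec | w.2 s j ∈ capacitySegment (M.bidLower s j) (M.bidUpper s j)} :=
    (isClosed_capacitySegment _ _).preimage (by fun_prop)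
  convert isClosed_iInter fun s => (isClosed_balanced s).inter
    ((isClosed_iInter (isClosed_offers s)).inter (isClosed_iInter (isClosed_bids s))) using 1
  ext w
  simp [feasible, feasibleFor, capacitySegment]

theorem isCompact_feasible (hM : ∀ s j, M.bidUpper s j ≠ ⊤) : IsCompact M.feasible := by
  choose β hβ using fun s j => WithTop.ne_top_iff_exists.1 (hM s j)
  refine (isCompact_Icc (a := (M.offerLower, M.bidLower))
    (b := (fun s i => M.excessDemand s + ∑ j, β s j - ∑ k, M.offerLower s k + M.offerLower s i,
      β))).of_isClosed_subset M.isClosed_feasible fun w hw => ?_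
  have bid_le : ∀ s j, w.2 s j ≤ β s j := fun s j =>
    WithTop.coe_le_coe.1 (((hw s).2.2 j).2.trans_eq (hβ s j).symm)
  refine ⟨⟨fun s i => ((hw s).2.1 i).1, fun s j => ((hw s).2.2 j).1⟩, fun s i => ?_, bid_le⟩
  have excess_le := Finset.single_le_sum (f := fun k => w.1 s k - M.offerLower s k)
    (fun k _ => sub_nonneg.2 ((hw s).2.1 k).1) (Finset.mem_univ i)
  rw [Finset.sum_sub_distrib] at excess_le
  have sum_bid_le : ∑ j, w.2 s j ≤ ∑ j, β s j := Finset.sum_le_sum fun j _ => bid_le s j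
  dsimp only
  linarith [(hw s).1]

/-- The map of the variational inequality of the market: the prices at `w`, acting on vectors as
the linear form `v ↦ ∑ g_{is}(w) x_{is} - ∑ h_{js}(w) y_{js}`. -/
noncomputable def priceForm (M : Market n I J) (w : M.Vec) : M.Vec →L[ℝ] ℝ :=
  ∑ s, (∑ i, M.offerPrice s i w •
      (ContinuousLinearMap.proj i ∘L ContinuousLinearMap.proj s ∘L ContinuousLinearMap.fst ℝ _ _)
    - ∑ j, M.bidPrice s j w •
      (ContinuousLinearMap.proj j ∘L ContinuousLinearMap.proj s ∘L ContinuousLinearMap.snd ℝ _ _))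

theorem priceForm_sub (M : Market n I J) (w v : M.Vec) :
    M.priceForm w (v - w) = ∑ s, (∑ i, M.offerPrice s i w * (v.1 s i - w.1 s i)
      - ∑ j, M.bidPrice s j w * (v.2 s j - w.2 s j)) := by
  simp [priceForm]

theorem exists_solvesVI_of_bidUpper_ne_top (hM : ∀ s j, M.bidUpper s j ≠ ⊤)
    (hW : M.feasible.Nonempty) (hg : ∀ s i, ContinuousOn (M.offerPrice s i) M.feasible)
    (hh : ∀ s j, ContinuousOn (M.bidPrice s j) M.feasible) : ∃ w, M.SolvesVI w := by
  have continuousOn_priceForm : ContinuousOn M.priceForm M.feasible :=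
    continuousOn_finsetSum _ fun s _ =>
      (continuousOn_finsetSum _ fun i _ => (hg s i).smul continuousOn_const).sub
        (continuousOn_finsetSum _ fun j _ => (hh s j).smul continuousOn_const)
  obtain ⟨w, hw, hvi⟩ := exists_variational_inequality hW (isCompact_feasible hM)
    M.convex_feasible continuousOn_priceForm
  exact ⟨w, hw, fun v hv => M.priceForm_sub w v ▸ hvi v hv⟩

end BoundedBids

section CappedBids

/-- The market `M` with the bound `R` imposed on all bids without a capacity bound. -/
def capBids (M : Market n I J) (R : ℝ) : Market n I J :=
  { M with bidUpper := fun s j => ((M.bidUpper s j).untopD R : ℝ) }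

theorem coe_le_capBids_bidUpper {s : Fin n} {j : M.buyers s} {t : ℝ} :
    (t : WithTop ℝ) ≤ (M.capBids R).bidUpper s j ↔
      (t : WithTop ℝ) ≤ M.bidUpper s j ∧ (M.bidUpper s j = ⊤ → t ≤ R) := by
  change (t : WithTop ℝ) ≤ ((M.bidUpper s j).untopD R : ℝ) ↔ _
  cases M.bidUpper s j <;> simp

theorem mem_feasible_capBids :
    w ∈ (M.capBids R).feasible ↔ w ∈ M.feasible ∧ ∀ s j, M.bidUpper s j = ⊤ → w.2 s j ≤ R :=
  ⟨fun hw => ⟨fun s => ⟨(hw s).1, (hw s).2.1, fun j =>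
      ⟨((hw s).2.2 j).1, (coe_le_capBids_bidUpper.1 ((hw s).2.2 j).2).1⟩⟩,
      fun s j => (coe_le_capBids_bidUpper.1 ((hw s).2.2 j).2).2⟩,
    fun ⟨hw, hR⟩ s => ⟨(hw s).1, (hw s).2.1, fun j =>
      ⟨((hw s).2.2 j).1, coe_le_capBids_bidUpper.2 ⟨((hw s).2.2 j).2, hR s j⟩⟩⟩⟩

theorem IsSupportingPrice.of_capBids (hp : (M.capBids R).IsSupportingPrice w p)
    (hw : w ∈ (M.capBids R).feasible)
    (hR : ∀ s l, M.bidUpper s l = ⊤ → w.2 s l = R →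
      ∃ k, M.offerLower s k < w.1 s k ∧ M.bidPrice s l w ≤ M.offerPrice s k w) :
    M.IsSupportingPrice w p := by
  refine fun s => ⟨(hp s).1, fun l t ht => ?_⟩
  by_cases hcap : M.bidUpper s l = ⊤ → t ≤ R
  · exact (hp s).2 l t ⟨ht.1, coe_le_capBids_bidUpper.2 ⟨ht.2, hcap⟩⟩
  obtain ⟨htop, htR⟩ := Classical.not_imp.1 hcap
  have bid_le : w.2 s l ≤ R := (mem_feasible_capBids.1 hw).2 s l htop
  have bidPrice_le : M.bidPrice s l w ≤ p s := by
    rcases bid_le.lt_or_eq with hlt | heq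
    · refine sub_nonneg.1 (nonneg_of_lt_upper ((hw s).2.2 l) ((hp s).2 l) ?_)
      simpa [capBids, htop] using hlt
    · obtain ⟨k, hk, hle⟩ := hR s l htop heq
      exact hle.trans (sub_nonpos.1 (nonpos_of_lower_lt ((hw s).2.1 k) ((hp s).1 k) hk))
  exact mul_nonneg (sub_nonneg.2 bidPrice_le) (sub_nonneg.2 (bid_le.trans (not_le.1 htR).le))

/-- Condition (C), weakened so that trader `k` may have a finite upper capacity bound. -/
def WeaklyCoercive (M : Market n I J) : Prop :=
  ∃ r : ℝ, ∀ w ∈ M.feasible, ∀ s l, M.bidUpper s l = ⊤ → max r (M.bidLower s l) < w.2 s l →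
    ∃ k, M.offerLower s k < w.1 s k ∧ M.bidPrice s l w ≤ M.offerPrice s k w

theorem Coercive.weaklyCoercive (hC : M.Coercive) : M.WeaklyCoercive :=
  let ⟨r, _, h⟩ := hC
  ⟨r, fun w hw s l hl hr => let ⟨k, _, hk⟩ := h w hw s l hl hr; ⟨k, hk⟩⟩

end CappedBids

end Market

theorem proposition2p2_general {n : ℕ} {I J : Type*} (M : Market n I J)
    (hW : M.feasible.Nonempty)
    (hg : ∀ (s : Fin n) (i : M.traders s), ContinuousOn (M.offerPrice s i) M.feasible)
    (hh : ∀ (s : Fin n) (j : M.buyers s), ContinuousOn (M.bidPrice s j) M.feasible)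
    (hC : M.WeaklyCoercive) :
    ∃ w : M.Vec, M.SolvesVI w ∧ (M.Nondegenerate → M.IsEquilibriumPoint w) := by
  obtain ⟨w₀, hw₀⟩ := hW
  obtain ⟨r, hC⟩ := hC
  obtain ⟨B, hB⟩ := Finite.bddAbove_range fun q : Σ s, M.buyers s => w₀.2 q.1 q.2
  have w₀_le (s j) : w₀.2 s j ≤ B := hB ⟨⟨s, j⟩, rfl⟩
  let R := max r B + 1
  have hrR : r < R := (le_max_left r B).trans_lt (lt_add_one _)
  have hBR : B < R := (le_max_right r B).trans_lt (lt_add_one _)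
  have feasible_subset : (M.capBids R).feasible ⊆ M.feasible := fun w hw =>
    (Market.mem_feasible_capBids.1 hw).1
  obtain ⟨w, hw⟩ := Market.exists_solvesVI_of_bidUpper_ne_top (M := M.capBids R)
    (fun _ _ => WithTop.coe_ne_top)
    ⟨w₀, Market.mem_feasible_capBids.2 ⟨hw₀, fun s j _ => (w₀_le s j).trans hBR.le⟩⟩
    (fun s i => (hg s i).mono feasible_subset) fun s j => (hh s j).mono feasible_subset
  have hwM : w ∈ M.feasible := feasible_subset hw.1
  obtain ⟨p, hp⟩ := hw.exists_isSupportingPrice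
  have hwVI : M.SolvesVI w := (hp.of_capBids hw.1 fun s l hl hwR =>
    hC w hwM s l hl (hwR ▸ max_lt hrR
      (((hw₀ s).2.2 l).1.trans_lt ((w₀_le s l).trans_lt hBR)))).solvesVI hwM
  exact ⟨w, hwVI, hwVI.isEquilibriumPoint⟩

theorem proposition2p2 {n : ℕ} {I J : Type*} (M : Market n I J)
    (hW : M.feasible.Nonempty)
    (hg : ∀ (s : Fin n) (i : M.traders s), ContinuousOn (M.offerPrice s i) M.feasible)
    (hh : ∀ (s : Fin n) (j : M.buyers s), ContinuousOn (M.bidPrice s j) M.feasible)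
    (hC : M.Coercive) :
    ∃ w : M.Vec, M.SolvesVI w ∧ (M.Nondegenerate → M.IsEquilibriumPoint w) :=
  proposition2p2_general M hW hg hh hC.weaklyCoercive
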